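/- For $n \ge 2$ let $U_n(\mathbb{Z})$ be the group of upper-triangular $n\times n$ integer matrices with ones on the diagonal, let $A_i$ ($1\le i\le n-1$) be the matrix that differs from the identity only by a one in position $(i,i+1)$, and let $S=\{A_1^{\pm1},\dots,A_{n-1}^{\pm1}\}$ be the standard generating set of $U_n(\mathbb{Z})$. Given a length function $\ell=\ell(n)$ with values in $\{0,1,2,\dots\}$, let $V=V_1V_2\cdots V_\ell$ and $W=W_1W_2\cdots W_\ell$ be the endpoints of two independent simple random walks of length $\ell$ on the Cayley graph of $U_n(\mathbb{Z})$ with respect to $S$, started at the identity (all the steps $V_i, W_i$ are independent and uniform on $S$), and let $G_{\ell,n}=\langle V,W\rangle\le U_n(\mathbb{Z})$. A nilpotent group $N$ has step $r$ if $r$ is the first index with $N_r$ trivial in the lower central series $N_0=N$, $N_{i}=[N,N_{i-1}]$; the group $G_{\ell,n}$ has full step if it has step $n-1$, which is the step of $U_n(\mathbb{Z})$. Asymptotically almost surely means with probability tending to $1$ as $n\to\infty$. Theorem. (1) If $\ell\in o(n^2)$, i.e. $\ell(n)/n^2\to 0$, then asymptotically almost surely $G_{\ell,n}$ does not have full step.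 (2) If $\ell\in\omega(n^3)$, i.e. $\ell(n)/n^3\to\infty$, then asymptotically almost surely $G_{\ell,n}$ has full step. -/

import Mathlib

open Filter Asymptotics Topology

namespace RandomNilpotent

/-- `U_n(ℤ)`: the group of upper-triangular `n × n` integer matrices with ones on the diagonal. -/
def U (n : ℕ) : Subgroup (Matrix.SpecialLinearGroup (Fin n) ℤ) where
  carrier := {M | (∀ i j : Fin n, j < i → M i j = 0) ∧ ∀ i : Fin n, M i i = 1}
  one_mem' := by
    refine ⟨fun i j h => ?_, fun i => ?_⟩
    · simp [h.ne']
    · simp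
  mul_mem' := by
    rintro A B ⟨hA, hA'⟩ ⟨hB, hB'⟩
    refine ⟨fun i j h => ?_, fun i => ?_⟩
    · rw [Matrix.SpecialLinearGroup.coe_mul, Matrix.mul_apply]
      refine Finset.sum_eq_zero fun k _ => ?_
      rcases lt_or_ge k i with hk | hk
      · rw [hA i k hk, zero_mul]
      · rw [hB k j (h.trans_le hk), mul_zero]
    · rw [Matrix.SpecialLinearGroup.coe_mul, Matrix.mul_apply, Finset.sum_eq_single i]
      · rw [hA', hB', mul_one]
      · intro k _ hk
        rcases lt_or_gt_of_ne hk with hk | hk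
        · rw [hA i k hk, zero_mul]
        · rw [hB k i hk, mul_zero]
      · intro h
        exact absurd (Finset.mem_univ i) h
  inv_mem' := by
    rintro A ⟨hA, hA'⟩
    have h1 : A.1 * (A⁻¹).1 = 1 := by
      rw [← Matrix.SpecialLinearGroup.coe_mul, mul_inv_cancel, Matrix.SpecialLinearGroup.coe_one]
    have h2 : (A⁻¹).1 * A.1 = 1 := by
      rw [← Matrix.SpecialLinearGroup.coe_mul, inv_mul_cancel, Matrix.SpecialLinearGroup.coe_one]
    have : Invertible A.1 := ⟨(A⁻¹).1, h2, h1⟩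
    have ht : Matrix.BlockTriangular A.1 id := fun i j h => hA i j h
    have hinv : A.1⁻¹ = (A⁻¹).1 := Matrix.inv_eq_right_inv h1
    have ht' : Matrix.BlockTriangular (A⁻¹).1 id := by
      rw [← hinv]
      exact Matrix.blockTriangular_inv_of_blockTriangular ht
    refine ⟨fun i j h => ht' h, fun i => ?_⟩
    have h3 : (A.1 * (A⁻¹).1) i i = 1 := by rw [h1, Matrix.one_apply_eq]
    rw [Matrix.mul_apply, Finset.sum_eq_single i] at h3
    · have h4 : A.1 i i = 1 := hA' i
      rwa [h4, one_mul] at h3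
    · intro k _ hk
      rcases lt_or_gt_of_ne hk with hk | hk
      · have h4 : A.1 i k = 0 := hA i k hk
        rw [h4, zero_mul]
      · rw [ht' hk, mul_zero]
    · intro h
      exact absurd (Finset.mem_univ i) h

/-- The superdiagonal elementary matrix `A_i = I + e_{i,i+1}`; the index `i` runs (from `0`) over
the `n - 1` superdiagonal positions. -/
def A {n : ℕ} (i : Fin (n - 1)) : U n :=
  ⟨Matrix.SpecialLinearGroup.transvection (F := ℤ)
      (i := (⟨i, by omega⟩ : Fin n)) (j := (⟨i + 1, by omega⟩ : Fin n)) (by simp) 1, by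
    refine ⟨fun a b h => ?_, fun a => ?_⟩
    · have h' : ¬((i : ℕ) = a ∧ (i : ℕ) + 1 = b) := by
        rintro ⟨h1, h2⟩
        have : (b : ℕ) < a := h
        omega
      simp [Matrix.SpecialLinearGroup.transvection_coe, h.ne', Fin.ext_iff, h']
    · have h' : ¬((i : ℕ) = a ∧ (i : ℕ) + 1 = a) := by omega
      simp [Matrix.SpecialLinearGroup.transvection_coe, Fin.ext_iff, h']⟩

/-- The standard generating set `S = {A_1^{±1}, …, A_{n-1}^{±1}}` of `U_n(ℤ)`. -/
def S (n : ℕ) : Set (U n) :=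
  Set.range (fun i : Fin (n - 1) => A i) ∪ Set.range (fun i : Fin (n - 1) => (A i)⁻¹)

instance instFiniteS (n : ℕ) : Finite (S n) :=
  ((Set.finite_range _).union (Set.finite_range _)).to_subtype

/-- A word `V_1 V_2 ⋯ V_ℓ` of length `ℓ` in the standard generators: the steps of a walk of length
`ℓ` on the Cayley graph of `U_n(ℤ)` that starts at the identity. -/
abbrev Word (n ℓ : ℕ) : Type := Fin ℓ → S n

/-- The endpoint of the walk, i.e. the product `V_1 V_2 ⋯ V_ℓ` in `U_n(ℤ)`. -/
def Word.endpoint {n ℓ : ℕ} (v : Word n ℓ) : U n :=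
  (List.ofFn fun k => (v k : U n)).prod

/-- The subgroup `⟨V, W⟩` of `U_n(ℤ)` generated by the endpoints of two walks. -/
def G {n ℓ : ℕ} (p : Word n ℓ × Word n ℓ) : Subgroup (U n) :=
  Subgroup.closure {p.1.endpoint, p.2.endpoint}

/-- The probability that `G_{ℓ,n}` has the property `P`. The two simple random walks are
independent, each with `ℓ` independent steps that are uniform on the finite set `S`; so the pair of
words is uniform on the finite set of all pairs of words of length `ℓ`. -/
noncomputable def prob (n ℓ : ℕ) (P : Subgroup (U n) → Prop) : ℝ :=
  (Nat.card {p : Word n ℓ × Word n ℓ // P (G p)} : ℝ) / (Nat.card (Word n ℓ × Word n ℓ) : ℝ)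

/-- `H` is nilpotent of step `r`: in the lower central series `H = H_0 ≥ H_1 ≥ ⋯`,
with `H_{k+1} = [H_k, H]`, the first trivial term is `H_r`. -/
def IsOfStep {Γ : Type*} [Group Γ] (H : Subgroup Γ) (r : ℕ) : Prop :=
  IsLeast {k : ℕ | H.lowerCentralSeries k = ⊥} r

/-- A subgroup of `U_n(ℤ)` has full step if it is of step `n - 1`, the step of `U_n(ℤ)`. -/
def HasFullStep (n : ℕ) (H : Subgroup (U n)) : Prop := IsOfStep H (n - 1)

/-- For a length function `ℓ`, asymptotically almost surely `G_{ℓ(n),n}` has the property `P`. -/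
def AAS (ℓ : ℕ → ℕ) (P : ∀ n : ℕ, Subgroup (U n) → Prop) : Prop :=
  Tendsto (fun n : ℕ => prob n (ℓ n) (P n)) atTop (𝓝 1)

end RandomNilpotent

/-! Whether ⟨V, W⟩ has full step is controlled by the superdiagonals of V and W, and these perform
independent simple random walks on ℤ^N with N = n - 1. If both superdiagonals vanish at the same
place i, then a grading that identifies the indices i and i + 1 shows that the step drops
(`not_hasFullStep`). If the superdiagonal v of V has no zero, the corner entry of the iterated
commutator [[⋯[W, V], ⋯], V] is, up to sign, ∏ v_i times the (n - 2)-th finite difference of w_i /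
v_i. This is a linear form in w with nonzero coefficients, so full step fails only if that form
vanishes (`exists_hasFullStep`). The probabilities come from Fourier inversion. A given coordinate
of one walk vanishes with probability of order √(N/ℓ) for ℓ ≥ N, so the expected number of common
zeros is of order N²/ℓ. For ℓ = o(n²) this tends to infinity, and negative correlation with the
second moment method produces a common zero (`card_none_mul_le`). For ℓ = ω(n³) a union bound
N√(N/ℓ) → 0 excludes zeros of v, while a form with nonzero coefficients vanishes with probability at
most the mean of |cos|^ℓ, which tends to 0 (`card_walkForm_le`, `tendsto_cosMoment`). -/

namespace RandomNilpotent

open scoped commutatorElement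

/-! ### Gradings of the indices and the filtrations they induce -/

/-- The matrix of an element of `U_n(ℤ)`, as a monoid homomorphism. -/
def mat (n : ℕ) : U n →* Matrix (Fin n) (Fin n) ℤ where
  toFun M := M.1.1
  map_one' := rfl
  map_mul' _ _ := rfl

lemma mat_injective (n : ℕ) : Function.Injective (mat n) :=
  fun _ _ h => Subtype.ext (Subtype.ext h)

lemma mat_diag {n : ℕ} (M : U n) (i : Fin n) : mat n M i i = 1 := M.2.2 i

lemma mat_eq_zero {n : ℕ} (M : U n) {i j : Fin n} (h : j < i) : mat n M i j = 0 := M.2.1 i j h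

lemma mat_inv_mul {n : ℕ} (M : U n) : mat n M⁻¹ * mat n M = 1 := by
  rw [← map_mul, inv_mul_cancel, map_one]

/-- With respect to the grading `h` of the indices, the matrix `X` has degree at least `k`. -/
def Raises {n : ℕ} (h : Fin n → ℕ) (k : ℕ) (X : Matrix (Fin n) (Fin n) ℤ) : Prop :=
  ∀ a b, X a b ≠ 0 → h a + k ≤ h b

namespace Raises

variable {n : ℕ} {h : Fin n → ℕ} {j k : ℕ} {X Y : Matrix (Fin n) (Fin n) ℤ}

lemma zero : Raises h k (0 : Matrix (Fin n) (Fin n) ℤ) := fun _ _ hab => absurd rfl hab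

lemma add (hX : Raises h k X) (hY : Raises h k Y) : Raises h k (X + Y) := by
  intro a b hab
  by_cases h1 : X a b = 0
  · refine hY a b fun h2 => hab ?_
    simp [h1, h2]
  · exact hX a b h1

lemma neg (hX : Raises h k X) : Raises h k (-X) := by
  intro a b hab
  exact hX a b (by simpa using hab)

lemma sub (hX : Raises h k X) (hY : Raises h k Y) : Raises h k (X - Y) := by
  rw [sub_eq_add_neg]
  exact hX.add hY.neg

lemma mul (hX : Raises h j X) (hY : Raises h k Y) : Raises h (j + k) (X * Y) := by
  intro a b hab
  rw [Matrix.mul_apply] at hab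
  obtain ⟨m, -, hm⟩ := Finset.exists_ne_zero_of_sum_ne_zero hab
  have h1 := hX a m (left_ne_zero_of_mul hm)
  have h2 := hY m b (right_ne_zero_of_mul hm)
  omega

lemma mat (hh : Monotone h) (M : U n) : Raises h 0 (mat n M) := by
  intro a b hab
  by_contra hlt
  refine hab (mat_eq_zero M ?_)
  by_contra hle
  exact hlt (hh (not_lt.mp hle))

/-- The lowest-degree part of a product is the product of the lowest-degree parts. -/
lemma mul_apply_lowest (hX : Raises (fun a : Fin n => (a : ℕ)) j X)
    (hY : Raises (fun a : Fin n => (a : ℕ)) k Y) {a b c : Fin n} (hb : (b : ℕ) = a + j)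
    (hc : (c : ℕ) = b + k) : (X * Y) a c = X a b * Y b c := by
  rw [Matrix.mul_apply]
  refine Finset.sum_eq_single b (fun m _ hm => ?_) (fun hb => absurd (Finset.mem_univ b) hb)
  by_contra hne
  have h1 := hX a m (left_ne_zero_of_mul hne)
  have h2 := hY m c (right_ne_zero_of_mul hne)
  exact hm (Fin.ext (by dsimp at h1 h2; omega))

end Raises

/-- The filtration of `U_n(ℤ)` by the degree with respect to a monotone grading of the indices. -/
def filtration {n : ℕ} {h : Fin n → ℕ} (hh : Monotone h) (k : ℕ) : Subgroup (U n) where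
  carrier := {M | Raises h k (mat n M - 1)}
  one_mem' := by
    simpa using Raises.zero
  mul_mem' := by
    intro M N hM hN
    have h1 : mat n (M * N) - 1 = mat n M * (mat n N - 1) + (mat n M - 1) := by
      rw [map_mul]; noncomm_ring
    have h2 := (Raises.mat hh M).mul hN
    rw [zero_add] at h2
    simp only [Set.mem_ofPred_eq, h1]
    exact h2.add hM
  inv_mem' := by
    intro M hM
    have h1 : mat n M⁻¹ - 1 = -(mat n M⁻¹ * (mat n M - 1)) := by
      rw [mul_sub, mat_inv_mul]; noncomm_ring
    have h2 := (Raises.mat hh M⁻¹).mul hM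
    rw [zero_add] at h2
    simp only [Set.mem_ofPred_eq, h1]
    exact h2.neg

lemma mem_filtration {n : ℕ} {h : Fin n → ℕ} {hh : Monotone h} {k : ℕ} {M : U n} :
    M ∈ filtration hh k ↔ Raises h k (mat n M - 1) := Iff.rfl

/-- The ring commutator of M - 1 and N - 1 equals MN - NM. The remaining factor has degree 0, so
degrees add under group commutators. -/
lemma mat_commutator_sub_one {n : ℕ} (M N : U n) :
    mat n ⁅M, N⁆ - 1 = ((mat n M - 1) * (mat n N - 1) - (mat n N - 1) * (mat n M - 1)) *
      mat n (M⁻¹ * N⁻¹) := by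
  have h1 : (mat n M - 1) * (mat n N - 1) - (mat n N - 1) * (mat n M - 1) =
      mat n (M * N) - mat n (N * M) := by
    simp only [map_mul]; noncomm_ring
  rw [h1, sub_mul, ← map_mul, ← map_mul]
  have h2 : N * M * (M⁻¹ * N⁻¹) = 1 := by group
  rw [h2, map_one, commutatorElement_def, mul_assoc (M * N)]

lemma commutator_filtration_le {n : ℕ} {h : Fin n → ℕ} (hh : Monotone h) (j k : ℕ) :
    ⁅filtration hh j, filtration hh k⁆ ≤ filtration hh (j + k) := by
  rw [Subgroup.commutator_le]
  intro M hM N hN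
  rw [mem_filtration] at hM hN ⊢
  rw [mat_commutator_sub_one]
  have h1 := hM.mul hN
  have h2 := hN.mul hM
  rw [add_comm k j] at h2
  exact (h1.sub h2).mul (Raises.mat hh _)

lemma lowerCentralSeries_le_filtration {n : ℕ} {h : Fin n → ℕ} (hh : Monotone h)
    {H : Subgroup (U n)} (hH : H ≤ filtration hh 1) (k : ℕ) :
    H.lowerCentralSeries k ≤ filtration hh (k + 1) := by
  induction k with
  | zero => exact hH
  | succ k ih =>
    exact (Subgroup.commutator_mono ih hH).trans (commutator_filtration_le hh (k + 1) 1)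

lemma filtration_eq_bot {n : ℕ} {h : Fin n → ℕ} (hh : Monotone h) {k : ℕ} (hk : ∀ a, h a < k) :
    filtration hh k = ⊥ := by
  rw [eq_bot_iff]
  intro M hM
  rw [Subgroup.mem_bot]
  apply mat_injective n
  rw [map_one, ← sub_eq_zero]
  ext a b
  by_contra hne
  have := mem_filtration.mp hM a b hne
  have := hk b
  omega

lemma monotone_val (n : ℕ) : Monotone (fun a : Fin n => (a : ℕ)) := fun _ _ h => h

lemma filtration_val_one (n : ℕ) : filtration (monotone_val n) 1 = ⊤ := by
  rw [eq_top_iff]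
  intro M _ a b hab
  by_contra hlt
  rcases (show b ≤ a by rw [Fin.le_def]; dsimp at hlt; omega).lt_or_eq with hba | rfl
  · exact hab (by rw [Matrix.sub_apply, mat_eq_zero M hba, Matrix.one_apply_ne hba.ne', sub_zero])
  · exact hab (by rw [Matrix.sub_apply, mat_diag, Matrix.one_apply_eq, sub_self])

/-! ### The superdiagonal -/

/-- The `i`-th superdiagonal entry, and `0` out of range. -/
def superdiag {n : ℕ} (M : U n) (i : ℕ) : ℤ :=
  if h : i + 1 < n then mat n M ⟨i, by omega⟩ ⟨i + 1, h⟩ else 0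

lemma raises_sub_one {n : ℕ} (M : U n) : Raises (fun a : Fin n => (a : ℕ)) 1 (mat n M - 1) := by
  have : M ∈ filtration (monotone_val n) 1 := by rw [filtration_val_one]; trivial
  exact this

lemma sub_one_apply {n : ℕ} (X : Matrix (Fin n) (Fin n) ℤ) {a b : Fin n} (h : a < b) :
    (X - 1) a b = X a b := by
  rw [Matrix.sub_apply, Matrix.one_apply_ne h.ne, sub_zero]

lemma superdiag_eq {n : ℕ} (M : U n) {a b : Fin n} (h : (b : ℕ) = a + 1) :
    superdiag M a = (mat n M - 1) a b := by
  have hb := b.2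
  rw [sub_one_apply _ (by rw [Fin.lt_def]; omega), superdiag, dif_pos (by omega)]
  exact congrArg (mat n M a) (Fin.ext h.symm)

lemma superdiag_mul {n : ℕ} (M N : U n) (i : ℕ) :
    superdiag (M * N) i = superdiag M i + superdiag N i := by
  by_cases h : i + 1 < n
  · have e : ∀ M : U n, superdiag M i = (mat n M - 1) ⟨i, by omega⟩ ⟨i + 1, h⟩ := fun M =>
      superdiag_eq M (a := ⟨i, by omega⟩) (b := ⟨i + 1, h⟩) rfl
    have h1 : mat n (M * N) - 1 = (mat n M - 1) * (mat n N - 1) + (mat n M - 1) + (mat n N - 1) := by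
      rw [map_mul]; noncomm_ring
    have h2 : ((mat n M - 1) * (mat n N - 1)) ⟨i, by omega⟩ ⟨i + 1, h⟩ = 0 := by
      by_contra hne
      have := ((raises_sub_one M).mul (raises_sub_one N)) _ _ hne
      dsimp at this
      omega
    rw [e, e, e, h1, Matrix.add_apply, Matrix.add_apply, h2, zero_add]
  · simp [superdiag, h]

/-- The superdiagonal as a homomorphism to an additive group. -/
def superdiagHom (n : ℕ) : U n →* Multiplicative (ℕ → ℤ) where
  toFun M := Multiplicative.ofAdd (superdiag M)
  map_one' := by
    have h := funext (superdiag_mul (1 : U n) 1)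
    have h0 : superdiag (1 : U n) = 0 := by
      funext i
      have := congrFun h i
      rw [mul_one] at this
      simpa using this
    rw [h0]; rfl
  map_mul' M N := by
    rw [← ofAdd_add]
    exact congrArg _ (funext (superdiag_mul M N))

lemma superdiag_inv {n : ℕ} (M : U n) (i : ℕ) : superdiag M⁻¹ i = -superdiag M i :=
  congrFun (congrArg Multiplicative.toAdd (map_inv (superdiagHom n) M)) i

lemma superdiag_list_prod {n : ℕ} (L : List (U n)) (i : ℕ) :
    superdiag L.prod i = (L.map fun M => superdiag M i).sum := by
  induction L with
  | nil =>
    exact congrFun (congrArg Multiplicative.toAdd (map_one (superdiagHom n))) i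
  | cons M L ih => rw [List.prod_cons, superdiag_mul, List.map_cons, List.sum_cons, ih]

lemma superdiag_A {n : ℕ} (i : Fin (n - 1)) (j : ℕ) :
    superdiag (A i) j = if j = (i : ℕ) then 1 else 0 := by
  have hi := i.2
  unfold superdiag
  split_ifs with h1 h2 h2
  · subst h2
    simp [mat, A, Matrix.SpecialLinearGroup.transvection_coe]
  · have : ¬((i : ℕ) = j ∧ (i : ℕ) + 1 = j + 1) := by omega
    simp [mat, A, Matrix.SpecialLinearGroup.transvection_coe, Fin.ext_iff, Ne.symm h2]
  · omega
  · rfl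

/-! ### Full step in terms of superdiagonals -/

/-- A grading that identifies the indices `i` and `i + 1`. -/
lemma monotone_collapse (n i : ℕ) :
    Monotone (fun a : Fin n => if i < (a : ℕ) then (a : ℕ) - 1 else a) := by
  intro a b hab
  have : (a : ℕ) ≤ b := hab
  dsimp only
  split_ifs <;> omega

/-- The entry at (i, i + 1) is the only one above the diagonal whose degree becomes 0 in the
collapsed grading. -/
lemma mem_filtration_collapse {n i : ℕ} {M : U n} (hM : superdiag M i = 0) :
    M ∈ filtration (monotone_collapse n i) 1 := by
  intro a b hab
  have h1 := raises_sub_one M a b hab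
  have ha := a.2
  have hb := b.2
  have h2 : ¬((a : ℕ) = i ∧ (b : ℕ) = i + 1) := by
    rintro ⟨h2, h3⟩
    rw [← h2, superdiag_eq M (a := a) (b := b) (by omega)] at hM
    exact hab hM
  dsimp only at h1 ⊢
  split_ifs <;> omega

/-- A common zero on the superdiagonal makes the step drop. -/
lemma not_hasFullStep {n : ℕ} {V W : U n} {i : ℕ} (hi : i + 1 < n) (hV : superdiag V i = 0)
    (hW : superdiag W i = 0) : ¬ HasFullStep n (Subgroup.closure {V, W}) := by
  intro hfull
  have hH : Subgroup.closure {V, W} ≤ filtration (monotone_collapse n i) 1 := by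
    rw [Subgroup.closure_le]
    rintro M (rfl | rfl)
    · exact mem_filtration_collapse hV
    · exact mem_filtration_collapse hW
  -- The collapsed grading takes values at most n - 2, so its filtration is already trivial at level
  -- n - 1.
  have h1 := lowerCentralSeries_le_filtration _ hH (n - 2)
  rw [filtration_eq_bot, le_bot_iff] at h1
  · have : n - 1 ≤ n - 2 := hfull.2 h1
    omega
  · intro a
    have ha := a.2
    split_ifs <;> omega

lemma hasFullStep_of_ne_bot {n : ℕ} (hn : 2 ≤ n) {H : Subgroup (U n)}
    (hH : H.lowerCentralSeries (n - 2) ≠ ⊥) : HasFullStep n H := by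
  constructor
  · have h1 := lowerCentralSeries_le_filtration (monotone_val n) (H := H)
      (by rw [filtration_val_one]; exact le_top) (n - 1)
    rw [filtration_eq_bot, le_bot_iff] at h1
    · exact h1
    · intro a
      have ha := a.2
      omega
  · intro k hk
    by_contra hlt
    have h2 := H.lowerCentralSeries_antitone (show k ≤ n - 2 by omega)
    rw [show H.lowerCentralSeries k = ⊥ from hk, le_bot_iff] at h2
    exact hH h2

/-- The iterated commutator `[[⋯[W, V], ⋯], V]`. -/
def iterComm {n : ℕ} (V W : U n) : ℕ → U n
  | 0 => W
  | k + 1 => ⁅iterComm V W k, V⁆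

lemma iterComm_mem {n : ℕ} (V W : U n) (k : ℕ) :
    iterComm V W k ∈ (Subgroup.closure {V, W}).lowerCentralSeries k := by
  induction k with
  | zero => exact Subgroup.subset_closure (by simp [iterComm])
  | succ k ih => exact Subgroup.commutator_mem_commutator ih (Subgroup.subset_closure (by simp))

lemma iterComm_raises {n : ℕ} (V W : U n) (k : ℕ) :
    Raises (fun a : Fin n => (a : ℕ)) (k + 1) (mat n (iterComm V W k) - 1) :=
  lowerCentralSeries_le_filtration (monotone_val n)
    (by rw [filtration_val_one]; exact le_top) k (iterComm_mem V W k)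

/-- Only lowest-degree parts reach the diagonal at distance k + 2; there the unitriangular factor in
`mat_commutator_sub_one` acts through its diagonal, as 1. -/
lemma iterComm_succ_apply {n : ℕ} (V W : U n) (k : ℕ) {a a' c c' : Fin n}
    (ha : (a' : ℕ) = a + 1) (hc' : (c' : ℕ) = a + k + 1) (hc : (c : ℕ) = c' + 1) :
    (mat n (iterComm V W (k + 1)) - 1) a c =
      (mat n (iterComm V W k) - 1) a c' * superdiag V c' -
        superdiag V a * (mat n (iterComm V W k) - 1) a' c := by
  have hX := iterComm_raises V W k
  have hY := raises_sub_one V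
  have h1 := hX.mul hY
  have h2 := hY.mul hX
  rw [add_comm 1 (k + 1)] at h2
  rw [iterComm, mat_commutator_sub_one,
    (h1.sub h2).mul_apply_lowest (Raises.mat (monotone_val n) _) (b := c) (by omega) (by omega),
    mat_diag, mul_one, Matrix.sub_apply, hX.mul_apply_lowest hY (b := c') (by omega) (by omega),
    hY.mul_apply_lowest hX (b := a') (by omega) (by omega), superdiag_eq V hc, superdiag_eq V ha]

/-- Dividing the recursion of `iterComm_succ_apply` by the product of the entries of V from a to a +
k + 1 turns its right-hand side into minus a forward difference. -/
lemma iterComm_apply {n : ℕ} (V W : U n) (hV : ∀ i, i + 1 < n → superdiag V i ≠ 0) (k : ℕ) :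
    ∀ a c : Fin n, (c : ℕ) = a + k + 1 →
      (((mat n (iterComm V W k) - 1) a c : ℤ) : ℚ) =
        (-1) ^ k * ((fwdDiff 1)^[k] (fun i => (superdiag W i : ℚ) / superdiag V i)) (a : ℕ) *
          ∏ i ∈ Finset.range (k + 1), (superdiag V (a + i) : ℚ) := by
  induction k with
  | zero =>
    intro a c hc
    have h := hV a (by have := c.2; omega)
    have h' : (superdiag V a : ℚ) ≠ 0 := by exact_mod_cast h
    simp only [iterComm, pow_zero, Function.iterate_zero, id, one_mul, zero_add,
      Finset.prod_range_one, add_zero]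
    rw [← superdiag_eq W hc, div_mul_cancel₀ _ h']
  | succ k ih =>
    intro a c hc
    have hcn := c.2
    rw [iterComm_succ_apply V W k (a' := ⟨a + 1, by omega⟩) (c' := ⟨a + k + 1, by omega⟩) rfl rfl hc]
    push_cast
    rw [ih a ⟨a + k + 1, by omega⟩ rfl, ih ⟨a + 1, by omega⟩ c (by dsimp only; omega),
      Function.iterate_succ_apply', fwdDiff, Finset.prod_range_succ _ (k + 1),
      Finset.prod_range_succ', Finset.prod_range_succ']
    simp only [add_zero, pow_succ]
    have e1 : ∏ i ∈ Finset.range (k + 1), (superdiag V (a + 1 + i) : ℚ) =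
        (∏ i ∈ Finset.range k, (superdiag V (a + (i + 1)) : ℚ)) * superdiag V (a + (k + 1)) := by
      rw [Finset.prod_range_succ]
      congr 1
      · exact Finset.prod_congr rfl fun i _ => by rw [show (a : ℕ) + 1 + i = a + (i + 1) by omega]
      · rw [show (a : ℕ) + 1 + k = a + (k + 1) by omega]
    have e2 := Finset.prod_range_succ' (fun i => (superdiag V (a + 1 + i) : ℚ)) k
    rw [add_zero] at e2
    rw [← e2, e1, show (a : ℕ) + k + 1 = a + (k + 1) by omega]
    ring

/-- If the superdiagonal of `V` has no zeros, then `⟨V, W⟩` has full step unless the superdiagonal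
of `W` satisfies a certain linear equation, all of whose coefficients are nonzero. -/
lemma exists_hasFullStep {n : ℕ} (hn : 2 ≤ n) (V : U n)
    (hV : ∀ i, i + 1 < n → superdiag V i ≠ 0) :
    ∃ c : Fin (n - 1) → ℤ, (∀ i, c i ≠ 0) ∧ ∀ W : U n, ∑ i, c i * superdiag W i ≠ 0 →
      HasFullStep n (Subgroup.closure {V, W}) := by
  obtain ⟨m, rfl⟩ : ∃ m, n = m + 2 := ⟨n - 2, by omega⟩
  change ∃ c : Fin (m + 1) → ℤ, _
  have hV' : ∀ i : Fin (m + 1), superdiag V i ≠ 0 := fun i => hV i (by omega)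
  -- These are the coefficients of the m-th difference of the quotients w_i / v_i, with denominators
  -- cleared by ∏ v_j.
  refine ⟨fun i => (-1) ^ (m - i : ℕ) * (m.choose i) *
    ∏ j ∈ Finset.univ.erase i, superdiag V j, fun i => ?_, fun W hW => ?_⟩
  · refine mul_ne_zero (mul_ne_zero (pow_ne_zero _ (by norm_num)) ?_)
      (Finset.prod_ne_zero_iff.mpr fun j _ => hV' j)
    have := Nat.choose_pos (show (i : ℕ) ≤ m by omega)
    positivity
  · refine hasFullStep_of_ne_bot hn fun hbot => hW ?_
    have h1 : iterComm V W m = 1 := by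
      have := iterComm_mem V W m
      rwa [show (Subgroup.closure {V, W}).lowerCentralSeries m = ⊥ from hbot,
        Subgroup.mem_bot] at this
    have h2 := iterComm_apply V W hV m 0 (Fin.last (m + 1)) (by simp)
    rw [h1, map_one, sub_self, Matrix.zero_apply, Int.cast_zero] at h2
    have h3 : ∏ i ∈ Finset.range (m + 1), (superdiag V (((0 : Fin (m + 2)) : ℕ) + i) : ℚ) ≠ 0 := by
      refine Finset.prod_ne_zero_iff.mpr fun i hi => ?_
      rw [Fin.val_zero, zero_add]
      exact_mod_cast hV i (by rw [Finset.mem_range] at hi; omega)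
    have h4 := (mul_eq_zero.mp ((mul_eq_zero.mp h2.symm).resolve_right h3)).resolve_left
      (pow_ne_zero _ (by norm_num))
    rw [fwdDiff_iter_eq_sum_shift, ← Fin.sum_univ_eq_sum_range
      (fun k => ((-1 : ℤ) ^ (m - k) * (m.choose k : ℤ)) •
        ((superdiag W ((0 : Fin (m + 2)) + k • 1) : ℚ) /
          superdiag V ((0 : Fin (m + 2)) + k • 1)))] at h4
    have h5 : ((∑ i : Fin (m + 1), (-1) ^ (m - i : ℕ) * (m.choose i) *
        (∏ j ∈ Finset.univ.erase i, superdiag V j) * superdiag W i : ℤ) : ℚ) = 0 := by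
      have h6 := congrArg (· * ∏ j : Fin (m + 1), (superdiag V j : ℚ)) h4
      simp only [zero_mul, Finset.sum_mul] at h6
      rw [← h6]
      push_cast
      refine Finset.sum_congr rfl fun i _ => ?_
      have h7 : (superdiag V i : ℚ) ≠ 0 := by exact_mod_cast hV' i
      rw [← Finset.mul_prod_erase Finset.univ _ (Finset.mem_univ i)]
      simp only [Fin.val_zero, zero_add, smul_eq_mul, mul_one, zsmul_eq_mul]
      push_cast
      field_simp
    exact_mod_cast h5

/-! ### Fourier inversion for walks on ℤ^N -/

open Real MeasureTheory

/-- The value of the linear form with coefficients `c` at the endpoint of a walk on `ℤ^N`. The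
step `(k, u)` of the walk adds `u = ±1` to the `k`-th coordinate. -/
def walkForm {N ℓ : ℕ} (c : Fin N → ℤ) (x : Fin ℓ → Fin N × ℤˣ) : ℤ :=
  ∑ t, ((x t).2 : ℤ) * c (x t).1

/-- The exponential sum factors over the steps. Pairing u = 1 with u = -1 makes each factor real, so
only cosines remain. -/
lemma sum_cos_walk {N : ℕ} (ℓ : ℕ) (y : Fin N → ℝ) :
    ∑ x : Fin ℓ → Fin N × ℤˣ, cos (∑ t, (((x t).2 : ℤ) : ℝ) * y (x t).1) =
      (∑ k, 2 * cos (y k)) ^ ℓ := by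
  have h1 : ((∑ k, 2 * cos (y k) : ℝ) : ℂ) =
      ∑ s : Fin N × ℤˣ, Complex.exp (((((s.2 : ℤ) : ℝ) * y s.1 : ℝ) : ℂ) * Complex.I) := by
    rw [Fintype.sum_prod_type]
    push_cast
    refine Finset.sum_congr rfl fun k _ => ?_
    rw [UnitsInt.univ, Finset.sum_pair (by decide), Complex.two_cos]
    simp
  have h2 : (((∑ k, 2 * cos (y k)) ^ ℓ : ℝ) : ℂ) = ∑ x : Fin ℓ → Fin N × ℤˣ,
      Complex.exp (((∑ t, (((x t).2 : ℤ) : ℝ) * y (x t).1 : ℝ) : ℂ) * Complex.I) := by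
    rw [Complex.ofReal_pow, h1, Fintype.sum_pow]
    refine Finset.sum_congr rfl fun x _ => ?_
    rw [← Complex.exp_sum, Complex.ofReal_sum, Finset.sum_mul]
  have h3 := congrArg Complex.re h2
  rw [Complex.ofReal_re, Complex.re_sum] at h3
  rw [h3]
  exact Finset.sum_congr rfl fun x _ => (Complex.exp_ofReal_mul_I_re _).symm

lemma integral_cos_add_int_mul (a : ℝ) (b : ℤ) :
    ∫ θ in (-π)..π, cos (a + b * θ) = if b = 0 then 2 * π * cos a else 0 := by
  split_ifs with h
  · simp only [h, Int.cast_zero, zero_mul, add_zero, intervalIntegral.integral_const, smul_eq_mul]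
    ring
  · have hb : (b : ℝ) ≠ 0 := by exact_mod_cast h
    rw [intervalIntegral.integral_comp_add_mul (fun x => cos x) hb, integral_cos]
    have : sin (a + b * π) = sin (a + b * -π) := by
      have := sin_add_int_mul_two_pi (a + b * -π) b
      rw [← this]
      congr 1
      ring
    rw [this, sub_self, smul_zero]

lemma card_walkForm_eq_zero {N : ℕ} (ℓ : ℕ) (c : Fin N → ℤ) :
    (Nat.card {x : Fin ℓ → Fin N × ℤˣ // walkForm c x = 0} : ℝ) * (2 * π) =
      ∫ θ in (-π)..π, (∑ k, 2 * cos (c k * θ)) ^ ℓ := by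
  have h1 : ∀ θ : ℝ, (∑ k, 2 * cos (c k * θ)) ^ ℓ =
      ∑ x : Fin ℓ → Fin N × ℤˣ, cos (0 + (walkForm c x : ℤ) * θ) := by
    intro θ
    rw [← sum_cos_walk]
    refine Finset.sum_congr rfl fun x _ => ?_
    rw [walkForm, zero_add]
    push_cast
    rw [Finset.sum_mul]
    simp only [mul_assoc]
  simp_rw [h1]
  rw [intervalIntegral.integral_finsetSum
    fun x _ => Continuous.intervalIntegrable (by fun_prop) _ _]
  simp_rw [integral_cos_add_int_mul]
  rw [← Finset.sum_filter, Finset.sum_const, cos_zero, mul_one, nsmul_eq_mul,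
    Nat.card_eq_fintype_card, Fintype.card_subtype]

lemma card_walkForm_eq_zero_and {N : ℕ} (ℓ : ℕ) (c d : Fin N → ℤ) :
    (Nat.card {x : Fin ℓ → Fin N × ℤˣ // walkForm c x = 0 ∧ walkForm d x = 0} : ℝ) * (2 * π) ^ 2 =
      ∫ θ in (-π)..π, ∫ φ in (-π)..π, (∑ k, 2 * cos (c k * θ + d k * φ)) ^ ℓ := by
  have h1 : ∀ θ φ : ℝ, (∑ k, 2 * cos (c k * θ + d k * φ)) ^ ℓ =
      ∑ x : Fin ℓ → Fin N × ℤˣ, cos ((walkForm c x : ℤ) * θ + (walkForm d x : ℤ) * φ) := by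
    intro θ φ
    rw [← sum_cos_walk]
    refine Finset.sum_congr rfl fun x _ => ?_
    rw [walkForm, walkForm]
    push_cast
    rw [Finset.sum_mul, Finset.sum_mul, ← Finset.sum_add_distrib]
    simp only [mul_assoc, mul_add]
  have h2 : ∀ θ : ℝ, ∫ φ in (-π)..π, (∑ k, 2 * cos (c k * θ + d k * φ)) ^ ℓ =
      ∑ x : Fin ℓ → Fin N × ℤˣ,
        if walkForm d x = 0 then 2 * π * cos (0 + (walkForm c x : ℤ) * θ) else 0 := by
    intro θ
    simp_rw [h1]
    rw [intervalIntegral.integral_finsetSum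
      fun x _ => Continuous.intervalIntegrable (by fun_prop) _ _]
    simp_rw [integral_cos_add_int_mul, zero_add]
  simp_rw [h2, ← Finset.sum_filter]
  rw [intervalIntegral.integral_finsetSum
    fun x _ => Continuous.intervalIntegrable (by fun_prop) _ _]
  simp_rw [intervalIntegral.integral_const_mul, integral_cos_add_int_mul]
  rw [← Finset.mul_sum, ← Finset.sum_filter, Finset.filter_filter, Finset.sum_const, cos_zero,
    mul_one, nsmul_eq_mul, Nat.card_eq_fintype_card, Fintype.card_subtype]
  simp_rw [and_comm]
  ring

lemma card_walk (N ℓ : ℕ) : Nat.card (Fin ℓ → Fin N × ℤˣ) = (2 * N) ^ ℓ := by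
  simp [mul_comm]

/-! ### Vanishing of coordinates -/

/-- The probability that a given coordinate of the simple random walk of length `ℓ` on `ℤ^N`
vanishes. -/
noncomputable def returnProb (N ℓ : ℕ) : ℝ :=
  (2 * π)⁻¹ * ∫ θ in (-π)..π, (1 - (1 - cos θ) / N) ^ ℓ

lemma sum_ite_cos {N : ℕ} (hN : 0 < N) (i : Fin N) (θ : ℝ) :
    ∑ k, 2 * cos ((Pi.single i (1 : ℤ) : Fin N → ℤ) k * θ) =
      (2 * N) * (1 - (1 - cos θ) / N) := by
  have hN' : (N : ℝ) ≠ 0 := by positivity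
  have h : ∀ k, 2 * cos ((Pi.single i (1 : ℤ) : Fin N → ℤ) k * θ) =
      2 + if k = i then 2 * (cos θ - 1) else 0 := by
    intro k
    by_cases hk : k = i
    · subst hk; simp; ring
    · simp [hk]
  simp_rw [h]
  rw [Finset.sum_add_distrib, Finset.sum_ite_eq' Finset.univ i]
  simp
  field_simp
  ring

lemma card_coord_eq_zero {N : ℕ} (hN : 0 < N) (ℓ : ℕ) (i : Fin N) :
    (Nat.card {x : Fin ℓ → Fin N × ℤˣ // walkForm (Pi.single i 1) x = 0} : ℝ) =
      returnProb N ℓ * (2 * N) ^ ℓ := by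
  have h := card_walkForm_eq_zero ℓ (Pi.single i (1 : ℤ))
  simp_rw [sum_ite_cos hN, mul_pow (2 * (N : ℝ))] at h
  rw [intervalIntegral.integral_const_mul] at h
  have hpi : (2 * π) ≠ 0 := by positivity
  rw [eq_div_of_mul_eq hpi h, returnProb]
  field_simp

lemma sum_ite_cos_add {N : ℕ} (hN : 0 < N) {i j : Fin N} (hij : i ≠ j) (θ φ : ℝ) :
    ∑ k, 2 * cos ((Pi.single i (1 : ℤ) : Fin N → ℤ) k * θ +
      (Pi.single j (1 : ℤ) : Fin N → ℤ) k * φ) =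
      (2 * N) * (1 - (1 - cos θ) / N - (1 - cos φ) / N) := by
  have hN' : (N : ℝ) ≠ 0 := by positivity
  have h : ∀ k, 2 * cos ((Pi.single i (1 : ℤ) : Fin N → ℤ) k * θ +
      (Pi.single j (1 : ℤ) : Fin N → ℤ) k * φ) =
      2 + (if k = i then 2 * (cos θ - 1) else 0) + if k = j then 2 * (cos φ - 1) else 0 := by
    intro k
    by_cases hk : k = i
    · subst hk; simp [hij]; ring
    · by_cases hk' : k = j
      · subst hk'; simp [hk]; ring
      · simp [hk, hk']
  simp_rw [h]
  rw [Finset.sum_add_distrib, Finset.sum_add_distrib, Finset.sum_ite_eq' Finset.univ i,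
    Finset.sum_ite_eq' Finset.univ j]
  simp
  field_simp
  ring

/-- The vanishing of two distinct coordinates is negatively correlated. -/
lemma card_coord_eq_zero_and_le {N : ℕ} (hN : 4 ≤ N) (ℓ : ℕ) {i j : Fin N} (hij : i ≠ j) :
    (Nat.card {x : Fin ℓ → Fin N × ℤˣ //
      walkForm (Pi.single i 1) x = 0 ∧ walkForm (Pi.single j 1) x = 0} : ℝ) ≤
      returnProb N ℓ ^ 2 * (2 * N) ^ ℓ := by
  have hN' : (4 : ℝ) ≤ N := by exact_mod_cast hN
  have h := card_walkForm_eq_zero_and ℓ (Pi.single i (1 : ℤ)) (Pi.single j 1)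
  simp_rw [sum_ite_cos_add (by omega) hij, mul_pow (2 * (N : ℝ)),
    intervalIntegral.integral_const_mul] at h
  have hle : ∫ θ in (-π)..π, ∫ φ in (-π)..π, (1 - (1 - cos θ) / N - (1 - cos φ) / N) ^ ℓ ≤
      ∫ θ in (-π)..π, ∫ φ in (-π)..π, (1 - (1 - cos θ) / N) ^ ℓ * (1 - (1 - cos φ) / N) ^ ℓ := by
    have hpi : -π ≤ π := by linarith [pi_pos]
    refine intervalIntegral.integral_mono_on hpi ?_ ?_ fun θ _ =>
      intervalIntegral.integral_mono_on hpi ?_ ?_ fun φ _ => ?_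
    · exact (intervalIntegral.continuous_parametric_intervalIntegral_of_continuous'
        (by fun_prop) _ _).intervalIntegrable _ _
    · exact (intervalIntegral.continuous_parametric_intervalIntegral_of_continuous'
        (by fun_prop) _ _).intervalIntegrable _ _
    · exact Continuous.intervalIntegrable (by fun_prop) _ _
    · exact Continuous.intervalIntegrable (by fun_prop) _ _
    -- The correlation bound is 1 - a - b ≤ (1 - a)(1 - b) for a, b ≥ 0. The bound 1/2, from N ≥ 4,
    -- keeps the left side nonnegative, so that powers preserve the inequality.
    · have hb : ∀ α : ℝ, 0 ≤ (1 - cos α) / N ∧ (1 - cos α) / N ≤ 1 / 2 := by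
        intro α
        have := cos_le_one α
        have := neg_one_le_cos α
        constructor
        · exact div_nonneg (by linarith) (by linarith)
        · rw [div_le_iff₀ (by linarith)]; linarith
      rw [← mul_pow]
      have h1 := hb θ
      have h2 := hb φ
      refine pow_le_pow_left₀ (by linarith) ?_ ℓ
      nlinarith [mul_nonneg h1.1 h2.1]
  simp_rw [intervalIntegral.integral_const_mul, intervalIntegral.integral_mul_const] at hle
  have hpi : (0 : ℝ) < 2 * π := by positivity
  rw [← mul_le_mul_iff_left₀ (pow_pos hpi 2), h, returnProb]
  calc _ ≤ _ := mul_le_mul_of_nonneg_left hle (by positivity)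
    _ = _ := by field_simp

lemma base_nonneg {N : ℕ} (hN : 2 ≤ N) (θ : ℝ) : 0 ≤ 1 - (1 - cos θ) / (N : ℝ) := by
  have hN' : (2 : ℝ) ≤ N := by exact_mod_cast hN
  have := neg_one_le_cos θ
  rw [sub_nonneg, div_le_one (by linarith)]
  linarith

/-- On [-π, π], cos θ ≤ 1 - 2θ²/π² bounds the integrand by a Gaussian, which is then integrated over
all of ℝ. -/
lemma returnProb_le {N ℓ : ℕ} (hN : 2 ≤ N) (hℓ : 0 < ℓ) :
    returnProb N ℓ ≤ (2 * π)⁻¹ * √(π ^ 3 / 2 * (N / ℓ)) := by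
  have hN' : (2 : ℝ) ≤ N := by exact_mod_cast hN
  have hℓ' : (0 : ℝ) < ℓ := by exact_mod_cast hℓ
  have hpi := pi_pos
  set b : ℝ := ℓ * (2 / π ^ 2) / N with hb
  have hb0 : 0 < b := by positivity
  have h1 : ∫ θ in (-π)..π, (1 - (1 - cos θ) / (N : ℝ)) ^ ℓ ≤
      ∫ θ in (-π)..π, exp (-b * θ ^ 2) := by
    refine intervalIntegral.integral_mono_on (by linarith)
      (Continuous.intervalIntegrable (by fun_prop) _ _)
      (Continuous.intervalIntegrable (by fun_prop) _ _) fun θ hθ => ?_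
    have h2 := cos_le_one_sub_mul_cos_sq (x := θ) (abs_le.mpr hθ)
    have h3 : 1 - (1 - cos θ) / (N : ℝ) ≤ exp (-(2 / π ^ 2 * θ ^ 2 / N)) := by
      have h4 := add_one_le_exp (-(2 / π ^ 2 * θ ^ 2 / N))
      have h5 : 2 / π ^ 2 * θ ^ 2 / N ≤ (1 - cos θ) / (N : ℝ) := by gcongr; linarith
      linarith
    calc _ ≤ exp (-(2 / π ^ 2 * θ ^ 2 / N)) ^ ℓ := pow_le_pow_left₀ (base_nonneg hN θ) h3 ℓ
      _ = _ := by
        rw [← exp_nat_mul]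
        congr 1
        rw [hb]
        ring
  have h2 : ∫ θ in (-π)..π, exp (-b * θ ^ 2) ≤ √(π / b) := by
    rw [← integral_gaussian, intervalIntegral.integral_of_le (by linarith)]
    exact setIntegral_le_integral (integrable_exp_neg_mul_sq hb0)
      (Eventually.of_forall fun _ => (exp_pos _).le)
  have h3 : π / b = π ^ 3 / 2 * (N / ℓ) := by
    rw [hb]
    field_simp
  rw [returnProb, ← h3]
  gcongr
  exact h1.trans h2

lemma le_returnProb {N : ℕ} (hN : 2 ≤ N) (ℓ : ℕ) :
    (4 * π)⁻¹ * √(N / (ℓ + N)) ≤ returnProb N ℓ := by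
  have hN' : (2 : ℝ) ≤ N := by exact_mod_cast hN
  have hℓ : (0 : ℝ) ≤ ℓ := by positivity
  have hpi := pi_gt_three
  -- On [0, δ], Bernoulli's inequality keeps the integrand at least 1/2. The extra N in the
  -- denominator ensures δ ≤ 1 and covers ℓ = 0.
  set δ : ℝ := √(N / (ℓ + N)) with hδ
  have hδ0 : 0 ≤ δ := sqrt_nonneg _
  have hδ2 : δ ^ 2 = N / (ℓ + N) := sq_sqrt (by positivity)
  have hδ1 : δ ≤ 1 := by
    rw [hδ, Real.sqrt_le_one]
    exact (div_le_one (by linarith)).mpr (by linarith)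
  have hcont : Continuous fun θ : ℝ => (1 - (1 - cos θ) / (N : ℝ)) ^ ℓ := by fun_prop
  have h1 : ∫ θ in (0 : ℝ)..δ, (1 - (1 - cos θ) / (N : ℝ)) ^ ℓ ≤
      ∫ θ in (-π)..π, (1 - (1 - cos θ) / (N : ℝ)) ^ ℓ :=
    intervalIntegral.integral_mono_interval (by linarith) hδ0 (by linarith)
      (Eventually.of_forall fun θ => pow_nonneg (base_nonneg hN θ) ℓ)
      (hcont.intervalIntegrable _ _)
  have h2 : ∫ θ in (0 : ℝ)..δ, (1 / 2 : ℝ) ≤ ∫ θ in (0 : ℝ)..δ, (1 - (1 - cos θ) / (N : ℝ)) ^ ℓ := by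
    refine intervalIntegral.integral_mono_on hδ0 (by simp) (hcont.intervalIntegrable _ _)
      fun θ hθ => ?_
    have h3 := one_sub_sq_div_two_le_cos (x := θ)
    have h4 : θ ^ 2 ≤ N / (ℓ + N) := hδ2 ▸ pow_le_pow_left₀ hθ.1 hθ.2 2
    have h5 : -((1 - cos θ) / (N : ℝ)) ≥ -2 := by linarith [base_nonneg hN θ]
    have h6 := one_add_mul_le_pow h5 ℓ
    have h7 : (1 - cos θ) ≤ N / (ℓ + N) / 2 := by linarith
    have h8 : ℓ * ((1 - cos θ) / (N : ℝ)) ≤ 1 / 2 := by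
      calc ℓ * ((1 - cos θ) / (N : ℝ)) ≤ ℓ * (N / (ℓ + N) / 2 / N) := by gcongr
        _ = ℓ / (ℓ + N) / 2 := by field_simp
        _ ≤ 1 / 2 := by
          gcongr
          exact (div_le_one (by linarith)).mpr (by linarith)
    rw [← sub_eq_add_neg] at h6
    linarith
  rw [returnProb]
  have h3 : δ / 2 ≤ ∫ θ in (-π)..π, (1 - (1 - cos θ) / (N : ℝ)) ^ ℓ := by
    refine le_trans (le_of_eq ?_) (h2.trans h1)
    simp
    ring
  calc (4 * π)⁻¹ * δ = (2 * π)⁻¹ * (δ / 2) := by ring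
    _ ≤ _ := by gcongr

/-! ### Vanishing of linear forms with nonzero coefficients -/

/-- The probability bound for a linear form with nonzero coefficients. -/
noncomputable def cosMoment (ℓ : ℕ) : ℝ := (2 * π)⁻¹ * ∫ θ in (-π)..π, |cos θ| ^ ℓ

lemma integral_abs_cos_int_mul (ℓ : ℕ) {c : ℤ} (hc : c ≠ 0) :
    ∫ θ in (-π)..π, |cos (c * θ)| ^ ℓ = ∫ θ in (-π)..π, |cos θ| ^ ℓ := by
  have hc' : (c : ℝ) ≠ 0 := by exact_mod_cast hc
  have hper : Function.Periodic (fun θ : ℝ => |cos θ| ^ ℓ) (2 * π) := fun θ => by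
    simp only [cos_add_two_pi]
  have hcont : Continuous fun θ : ℝ => |cos θ| ^ ℓ := by fun_prop
  rw [intervalIntegral.integral_comp_mul_left (fun θ => |cos θ| ^ ℓ) hc']
  have h1 := hper.intervalIntegral_add_zsmul_eq c (c * -π)
    (fun _ _ => hcont.intervalIntegrable _ _)
  have h2 := hper.intervalIntegral_add_eq (c * -π) (-π)
  rw [show (c : ℝ) * -π + c • (2 * π) = c * π by rw [zsmul_eq_mul]; ring, h2,
    show -π + 2 * π = π by ring] at h1
  rw [h1, zsmul_eq_mul, smul_eq_mul, inv_mul_cancel_left₀ hc']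

/-- By convexity the ℓ-th power of the average of |cos (c k * θ)| is at most the average of the ℓ-th
powers. By periodicity each of these has the same integral for every nonzero c k, so the bound does
not depend on c. -/
lemma card_walkForm_le {N : ℕ} (hN : 0 < N) (ℓ : ℕ) {c : Fin N → ℤ} (hc : ∀ i, c i ≠ 0) :
    (Nat.card {x : Fin ℓ → Fin N × ℤˣ // walkForm c x = 0} : ℝ) ≤
      cosMoment ℓ * (2 * N) ^ ℓ := by
  have hN' : (N : ℝ) ≠ 0 := by positivity
  have hpi : (0 : ℝ) < 2 * π := by positivity
  rw [← mul_le_mul_iff_left₀ hpi, card_walkForm_eq_zero]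
  have h1 : ∫ θ in (-π)..π, (∑ k, 2 * cos (c k * θ)) ^ ℓ ≤
      ∫ θ in (-π)..π, (2 * N : ℝ) ^ ℓ * ∑ k, (N : ℝ)⁻¹ * |cos (c k * θ)| ^ ℓ := by
    refine intervalIntegral.integral_mono_on (by linarith [pi_pos])
      (Continuous.intervalIntegrable (by fun_prop) _ _)
      (Continuous.intervalIntegrable (by fun_prop) _ _) fun θ _ => ?_
    have h2 := pow_arith_mean_le_arith_mean_pow Finset.univ (fun _ : Fin N => (N : ℝ)⁻¹)
      (fun k => |cos (c k * θ)|) (fun _ _ => by positivity) (by simp [hN']) (fun _ _ => abs_nonneg _) ℓ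
    calc (∑ k, 2 * cos (c k * θ)) ^ ℓ ≤ |∑ k, 2 * cos (c k * θ)| ^ ℓ := by
          rw [← abs_pow]; exact le_abs_self _
      _ ≤ (2 * N * ∑ k, (N : ℝ)⁻¹ * |cos (c k * θ)|) ^ ℓ := by
          refine pow_le_pow_left₀ (abs_nonneg _) ?_ ℓ
          rw [← Finset.mul_sum, ← Finset.mul_sum, abs_mul, abs_two]
          rw [show 2 * (N : ℝ) * ((N : ℝ)⁻¹ * ∑ k, |cos (c k * θ)|) = 2 * ∑ k, |cos (c k * θ)| by
            rw [mul_assoc, mul_inv_cancel_left₀ hN']]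
          gcongr
          exact Finset.abs_sum_le_sum_abs _ _
      _ ≤ _ := by
          rw [mul_pow]
          gcongr
  refine h1.trans (le_of_eq ?_)
  rw [intervalIntegral.integral_const_mul, intervalIntegral.integral_finsetSum
    fun x _ => Continuous.intervalIntegrable (by fun_prop) _ _]
  simp_rw [intervalIntegral.integral_const_mul, integral_abs_cos_int_mul ℓ (hc _)]
  rw [cosMoment, Finset.sum_const, Finset.card_univ, Fintype.card_fin, nsmul_eq_mul]
  field_simp

lemma tendsto_cosMoment : Tendsto cosMoment atTop (𝓝 0) := by
  have h : Tendsto (fun ℓ : ℕ => ∫ θ in (-π)..π, |cos θ| ^ ℓ) atTop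
      (𝓝 (∫ _ in (-π)..π, (0 : ℝ))) := by
    refine intervalIntegral.tendsto_integral_filter_of_dominated_convergence (fun _ => 1) ?_ ?_
      (by simp) ?_
    · exact Eventually.of_forall fun ℓ => Continuous.aestronglyMeasurable (by fun_prop)
    · refine Eventually.of_forall fun ℓ => Eventually.of_forall fun θ _ => ?_
      rw [norm_pow, norm_eq_abs, abs_abs]
      exact pow_le_one₀ (abs_nonneg _) (abs_cos_le_one θ)
    -- Pointwise convergence to 0 fails only where |cos θ| = 1, a null set.
    · have hcount : ({θ : ℝ | sin θ = 0}).Countable := by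
        refine (Set.countable_range fun n : ℤ => (n : ℝ) * π).mono fun θ hθ => ?_
        exact sin_eq_zero_iff.mp hθ
      filter_upwards [hcount.ae_notMem volume] with θ hθ _
      refine tendsto_pow_atTop_nhds_zero_of_lt_one (abs_nonneg _)
        (lt_of_le_of_ne (abs_cos_le_one θ) fun h1 => hθ ?_)
      have h2 : cos θ ^ 2 = 1 := by rw [← sq_abs, h1, one_pow]
      have h3 := sin_sq_add_cos_sq θ
      exact pow_eq_zero_iff (two_ne_zero) |>.mp (by linarith)
  have h' := h.const_mul (2 * π)⁻¹
  rwa [intervalIntegral.integral_zero, mul_zero] at h'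

/-! ### From words in the generators to walks on ℤ^(n-1) -/

/-- The generator `A_i ^ u` with `u = ±1`. -/
def gen {n : ℕ} (s : Fin (n - 1) × ℤˣ) : S n :=
  ⟨A s.1 ^ (s.2 : ℤ), by
    rcases Int.units_eq_one_or s.2 with h | h
    · exact Or.inl ⟨s.1, by simp [h]⟩
    · exact Or.inr ⟨s.1, by simp [h]⟩⟩

lemma superdiag_gen {n : ℕ} (s : Fin (n - 1) × ℤˣ) (j : ℕ) :
    superdiag (gen s : U n) j = s.2 * if j = (s.1 : ℕ) then 1 else 0 := by
  rcases Int.units_eq_one_or s.2 with h | h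
  · simp [gen, h, superdiag_A]
  · simp only [gen, h, superdiag_inv, superdiag_A, Units.val_neg, Units.val_one, zpow_neg, zpow_one,
      neg_one_mul]

/-- The superdiagonal of a generator recovers its index and sign. Hence uniform steps in S
correspond to uniform signed coordinate steps. -/
lemma gen_bijective (n : ℕ) : Function.Bijective (gen : Fin (n - 1) × ℤˣ → S n) := by
  constructor
  · intro s s' h
    have h1 : ∀ j, (s.2 : ℤ) * (if j = (s.1 : ℕ) then 1 else 0) =
        s'.2 * if j = (s'.1 : ℕ) then 1 else 0 := fun j => by
      rw [← superdiag_gen, ← superdiag_gen, h]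
    have h2 := h1 s.1
    rw [if_pos rfl, mul_one] at h2
    split_ifs at h2 with h3
    · exact Prod.ext (Fin.ext h3) (Units.ext (by simpa using h2))
    · exact absurd h2 (by simp)
  · rintro ⟨_, ⟨i, rfl⟩ | ⟨i, rfl⟩⟩
    · exact ⟨(i, 1), Subtype.ext (by simp [gen])⟩
    · exact ⟨(i, -1), Subtype.ext (by simp [gen])⟩

/-- Words in the generators are walks on `ℤ^(n-1)`. -/
noncomputable def wordEquiv (n ℓ : ℕ) : (Fin ℓ → Fin (n - 1) × ℤˣ) ≃ Word n ℓ :=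
  Equiv.piCongrRight fun _ => Equiv.ofBijective gen (gen_bijective n)

lemma sum_superdiag_endpoint {n ℓ : ℕ} (c : Fin (n - 1) → ℤ) (x : Fin ℓ → Fin (n - 1) × ℤˣ) :
    ∑ i : Fin (n - 1), c i * superdiag (wordEquiv n ℓ x).endpoint i = walkForm c x := by
  have h1 : ∀ i : ℕ, superdiag (wordEquiv n ℓ x).endpoint i =
      ∑ t, ((x t).2 : ℤ) * if i = ((x t).1 : ℕ) then 1 else 0 := by
    intro i
    rw [Word.endpoint, superdiag_list_prod, List.map_ofFn, List.sum_ofFn]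
    exact Finset.sum_congr rfl fun t _ => superdiag_gen (x t) i
  simp_rw [h1, Finset.mul_sum]
  rw [Finset.sum_comm]
  refine Finset.sum_congr rfl fun t _ => ?_
  simp [← Fin.ext_iff, mul_comm]

lemma superdiag_endpoint {n ℓ : ℕ} (x : Fin ℓ → Fin (n - 1) × ℤˣ) (i : Fin (n - 1)) :
    superdiag (wordEquiv n ℓ x).endpoint i = walkForm (Pi.single i 1) x := by
  rw [← sum_superdiag_endpoint]
  simp [Pi.single_apply]

lemma card_word (n ℓ : ℕ) : Nat.card (Word n ℓ) = (2 * (n - 1)) ^ ℓ := by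
  rw [← Nat.card_congr (wordEquiv n ℓ), card_walk]

lemma prob_le {n ℓ : ℕ} {Q : Subgroup (U n) → Prop}
    {R : (Fin ℓ → Fin (n - 1) × ℤˣ) × (Fin ℓ → Fin (n - 1) × ℤˣ) → Prop} {b : ℝ} (hb : 0 ≤ b)
    (hQR : ∀ q, Q (G (wordEquiv n ℓ q.1, wordEquiv n ℓ q.2)) → R q)
    (hR : (Nat.card {q // R q} : ℝ) ≤ b * ((2 * (n - 1 : ℕ)) ^ ℓ) ^ 2) : prob n ℓ Q ≤ b := by
  have h1 : Nat.card {p : Word n ℓ × Word n ℓ // Q (G p)} ≤ Nat.card {q // R q} := by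
    let e := (wordEquiv n ℓ).prodCongr (wordEquiv n ℓ)
    have h2 : Nat.card {q // Q (G (e q))} = Nat.card {p : Word n ℓ × Word n ℓ // Q (G p)} :=
      Nat.card_congr (e.subtypeEquiv fun _ => Iff.rfl)
    rw [← h2]
    exact Nat.card_le_card_of_injective (fun q => ⟨q.1, hQR q.1 q.2⟩)
      fun q q' h => Subtype.ext (congrArg (fun r => r.1) h)
  rw [prob]
  refine div_le_of_le_mul₀ (by positivity) hb (le_trans (Nat.cast_le.mpr h1) (hR.trans ?_))
  rw [Nat.card_prod, card_word]
  push_cast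
  rw [sq]

lemma prob_not {n ℓ : ℕ} (hn : 2 ≤ n) (P : Subgroup (U n) → Prop) :
    prob n ℓ P = 1 - prob n ℓ fun H => ¬ P H := by
  classical
  have h0 : Nat.card (Word n ℓ × Word n ℓ) ≠ 0 := by
    rw [Nat.card_prod, card_word]
    have : 0 < 2 * (n - 1) := by omega
    positivity
  have h1 : Nat.card {p : Word n ℓ × Word n ℓ // P (G p)} +
      Nat.card {p : Word n ℓ × Word n ℓ // ¬ P (G p)} = Nat.card (Word n ℓ × Word n ℓ) := by
    rw [← Nat.card_sum]
    exact Nat.card_congr (Equiv.sumCompl _)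
  have h2 : (Nat.card (Word n ℓ × Word n ℓ) : ℝ) ≠ 0 := by exact_mod_cast h0
  rw [prob, prob, eq_sub_iff_add_eq, ← add_div, div_eq_one_iff_eq h2]
  exact_mod_cast h1

lemma aas_of_prob_not_le {ℓ : ℕ → ℕ} {P : ∀ n : ℕ, Subgroup (U n) → Prop} {b : ℕ → ℝ}
    (hb : Tendsto b atTop (𝓝 0)) (hP : ∀ᶠ n in atTop, prob n (ℓ n) (fun H => ¬ P n H) ≤ b n) :
    AAS ℓ P := by
  have h1 : Tendsto (fun n => prob n (ℓ n) fun H => ¬ P n H) atTop (𝓝 0) :=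
    tendsto_of_tendsto_of_tendsto_of_le_of_le' tendsto_const_nhds hb
      (Eventually.of_forall fun n => by unfold prob; positivity) hP
  have h2 := h1.const_sub 1
  rw [sub_zero] at h2
  refine h2.congr' ?_
  filter_upwards [eventually_ge_atTop 2] with n hn
  exact (prob_not hn _).symm

/-! ### Second moment method and short walks -/

lemma card_subtype_eq_sum {Ω : Type*} [Fintype Ω] (p : Ω → Prop) [DecidablePred p] :
    (Nat.card {ω // p ω} : ℝ) = ∑ ω, if p ω then 1 else 0 := by
  rw [Nat.card_eq_fintype_card, Fintype.card_subtype, Finset.sum_boole]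

/-- The second moment method: among equally likely, pairwise negatively correlated events, at least
one is likely to occur. -/
lemma card_none_mul_le {Ω : Type*} [Fintype Ω] {N : ℕ} (E : Fin N → Ω → Prop) {q : ℝ} (hq : 0 ≤ q)
    (h1 : ∀ i, (Nat.card {ω // E i ω} : ℝ) = q * Nat.card Ω)
    (h2 : ∀ i j, i ≠ j → (Nat.card {ω // E i ω ∧ E j ω} : ℝ) ≤ q ^ 2 * Nat.card Ω) :
    (Nat.card {ω // ∀ i, ¬ E i ω} : ℝ) * (N * q) ≤ Nat.card Ω := by
  classical
  set T : ℝ := (Nat.card Ω : ℝ) with hT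
  have hT' : T = ∑ _ω : Ω, (1 : ℝ) := by simp [hT]
  set f : Fin N → Ω → ℝ := fun i ω => if E i ω then 1 else 0 with hf
  have hf1 : ∀ i, ∑ ω, f i ω = q * T := fun i => by rw [← h1, card_subtype_eq_sum]
  have hf2 : ∀ i j, ∑ ω, f i ω * f j ω ≤ q ^ 2 * T + if i = j then q * T else 0 := by
    intro i j
    split_ifs with hij
    · subst hij
      have : ∀ ω, f i ω * f i ω = f i ω := fun ω => by simp [hf]
      simp_rw [this]
      rw [hf1]
      have : 0 ≤ q ^ 2 * T := by positivity
      linarith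
    · rw [add_zero]
      refine le_trans (le_of_eq ?_) (h2 i j hij)
      rw [card_subtype_eq_sum]
      refine Finset.sum_congr rfl fun ω _ => ?_
      by_cases ha : E i ω <;> by_cases hb : E j ω <;> simp [hf, ha, hb]
  set μ : ℝ := N * q with hμ
  have hμ0 : 0 ≤ μ := by positivity
  have h3 : ∑ ω, (∑ i, f i ω) = μ * T := by
    rw [Finset.sum_comm]
    simp_rw [hf1]
    simp [hμ, mul_assoc]
  have h4 : ∑ ω, (∑ i, f i ω) ^ 2 ≤ μ ^ 2 * T + μ * T := by
    simp_rw [sq (∑ i, f i _), Finset.sum_mul_sum]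
    rw [Finset.sum_comm]
    calc ∑ i, ∑ ω, ∑ j, f i ω * f j ω = ∑ i, ∑ j, ∑ ω, f i ω * f j ω :=
          Finset.sum_congr rfl fun i _ => Finset.sum_comm
      _ ≤ ∑ i : Fin N, ∑ j : Fin N, (q ^ 2 * T + if i = j then q * T else 0) :=
          Finset.sum_le_sum fun i _ => Finset.sum_le_sum fun j _ => hf2 i j
      _ = μ ^ 2 * T + μ * T := by
          simp [Finset.sum_add_distrib, hμ]
          ring
  -- The variance of the number of events is at most its mean μ; each outcome with no event
  -- contributes μ² to the sum (Chebyshev).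
  have h5 : ∑ ω, (∑ i, f i ω - μ) ^ 2 ≤ μ * T := by
    have : ∀ ω, (∑ i, f i ω - μ) ^ 2 = (∑ i, f i ω) ^ 2 - 2 * μ * (∑ i, f i ω) + μ ^ 2 * 1 :=
      fun ω => by ring
    simp_rw [this]
    rw [Finset.sum_add_distrib, Finset.sum_sub_distrib, ← Finset.mul_sum, ← Finset.mul_sum, h3,
      ← hT']
    linarith
  have h6 : (Nat.card {ω // ∀ i, ¬ E i ω} : ℝ) * μ ^ 2 ≤ ∑ ω, (∑ i, f i ω - μ) ^ 2 := by
    rw [card_subtype_eq_sum, Finset.sum_mul]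
    refine Finset.sum_le_sum fun ω _ => ?_
    split_ifs with h
    · have : ∀ i, f i ω = 0 := fun i => if_neg (h i)
      simp [this]
    · rw [zero_mul]; positivity
  rcases hμ0.eq_or_lt with h | h
  · rw [← h, mul_zero]; positivity
  · have h7 := h6.trans h5
    rw [sq, ← mul_assoc, mul_comm μ T] at h7
    exact le_of_mul_le_mul_right h7 h

lemma card_subtype_prod {X Y : Type*} (p : X → Prop) (q : Y → Prop) :
    Nat.card {ω : X × Y // p ω.1 ∧ q ω.2} = Nat.card {x // p x} * Nat.card {y // q y} := by
  rw [← Nat.card_prod]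
  exact Nat.card_congr (Equiv.subtypeProdEquivProd)

lemma returnProb_nonneg {N : ℕ} (hN : 2 ≤ N) (ℓ : ℕ) : 0 ≤ returnProb N ℓ :=
  le_trans (by positivity) (le_returnProb hN ℓ)

/-- The number of pairs of walks without a common vanishing coordinate. -/
lemma card_no_common_zero_mul_le {N : ℕ} (hN : 4 ≤ N) (ℓ : ℕ) :
    (Nat.card {q : (Fin ℓ → Fin N × ℤˣ) × (Fin ℓ → Fin N × ℤˣ) // ∀ i,
      ¬ (walkForm (Pi.single i 1) q.1 = 0 ∧ walkForm (Pi.single i 1) q.2 = 0)} : ℝ) *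
      (N * returnProb N ℓ ^ 2) ≤ ((2 * N) ^ ℓ) ^ 2 := by
  have hT : (Nat.card ((Fin ℓ → Fin N × ℤˣ) × (Fin ℓ → Fin N × ℤˣ)) : ℝ) = ((2 * N) ^ ℓ) ^ 2 := by
    rw [Nat.card_prod, card_walk, sq]
    push_cast
    rfl
  rw [← hT]
  refine card_none_mul_le (fun i (q : (Fin ℓ → Fin N × ℤˣ) × (Fin ℓ → Fin N × ℤˣ)) =>
    walkForm (Pi.single i 1) q.1 = 0 ∧ walkForm (Pi.single i 1) q.2 = 0) (sq_nonneg _) ?_ ?_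
  · intro i
    rw [card_subtype_prod (fun x : Fin ℓ → Fin N × ℤˣ => walkForm (Pi.single i 1) x = 0)
      (fun x : Fin ℓ → Fin N × ℤˣ => walkForm (Pi.single i 1) x = 0), hT, Nat.cast_mul,
      card_coord_eq_zero (by omega)]
    ring
  · intro i j hij
    rw [Nat.card_congr (Equiv.subtypeEquivRight fun q => and_and_and_comm), card_subtype_prod
      (fun x : Fin ℓ → Fin N × ℤˣ => walkForm (Pi.single i 1) x = 0 ∧ walkForm (Pi.single j 1) x = 0)
      (fun x : Fin ℓ → Fin N × ℤˣ => walkForm (Pi.single i 1) x = 0 ∧ walkForm (Pi.single j 1) x = 0),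
      hT, Nat.cast_mul, ← sq]
    have h := card_coord_eq_zero_and_le hN ℓ hij
    calc _ ≤ (returnProb N ℓ ^ 2 * (2 * N) ^ ℓ) ^ 2 := pow_le_pow_left₀ (by positivity) h 2
      _ = _ := by ring

lemma prob_hasFullStep_le {n : ℕ} (hn : 5 ≤ n) (ℓ : ℕ) :
    prob n ℓ (HasFullStep n) ≤ 64 * Real.pi ^ 2 * ((ℓ + n) / n ^ 2) := by
  obtain ⟨N, rfl⟩ : ∃ N, n = N + 1 := ⟨n - 1, by omega⟩
  have hN : 4 ≤ N := by omega
  have hN' : (4 : ℝ) ≤ N := by exact_mod_cast hN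
  refine prob_le (by positivity) (fun q hq i hi => ?_) ?_ (R := fun q => ∀ i,
    ¬ (walkForm (Pi.single i 1) q.1 = 0 ∧ walkForm (Pi.single i 1) q.2 = 0))
  · rw [← superdiag_endpoint, ← superdiag_endpoint] at hi
    exact not_hasFullStep (by have := i.2; omega) hi.1 hi.2 hq
  · simp only [Nat.add_sub_cancel]
    have h1 := card_no_common_zero_mul_le hN ℓ
    set K : ℝ := (Nat.card {q : (Fin ℓ → Fin N × ℤˣ) × (Fin ℓ → Fin N × ℤˣ) // ∀ i,
      ¬ (walkForm (Pi.single i 1) q.1 = 0 ∧ walkForm (Pi.single i 1) q.2 = 0)} : ℝ)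
    have hpi := Real.pi_pos
    have hℓ : (0 : ℝ) < ℓ + N := by positivity
    have h2 : (16 * Real.pi ^ 2)⁻¹ * (N / (ℓ + N)) ≤ returnProb N ℓ ^ 2 := by
      have h3 := pow_le_pow_left₀ (by positivity) (le_returnProb (by omega : 2 ≤ N) ℓ) 2
      rw [mul_pow, Real.sq_sqrt (by positivity)] at h3
      refine le_trans (le_of_eq ?_) h3
      rw [inv_pow]
      ring
    have h3 : K * (N * ((16 * Real.pi ^ 2)⁻¹ * (N / (ℓ + N)))) ≤ ((2 * N) ^ ℓ) ^ 2 :=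
      le_trans (by gcongr) h1
    have h4 : K ≤ 16 * Real.pi ^ 2 * ((ℓ + N) / N ^ 2) * ((2 * N) ^ ℓ) ^ 2 := by
      calc K = 16 * Real.pi ^ 2 * ((ℓ + N) / N ^ 2) *
            (K * (N * ((16 * Real.pi ^ 2)⁻¹ * (N / (ℓ + N))))) := by field_simp
        _ ≤ _ := by gcongr
    refine h4.trans ?_
    refine mul_le_mul_of_nonneg_right ?_ (by positivity)
    -- The factor 4 pays for replacing N by n = N + 1.
    have h5 : ((ℓ : ℝ) + N) / N ^ 2 ≤ 4 * ((ℓ + (N + 1)) / (N + 1) ^ 2) := by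
      rw [mul_div_assoc', div_le_div_iff₀ (by positivity) (by positivity)]
      have h6 : ((N : ℝ) + 1) ^ 2 ≤ 4 * N ^ 2 := by nlinarith
      calc ((ℓ : ℝ) + N) * (N + 1) ^ 2 ≤ (ℓ + (N + 1)) * (4 * N ^ 2) := by
            gcongr
            linarith
        _ = _ := by ring
    push_cast
    calc 16 * Real.pi ^ 2 * (((ℓ : ℝ) + N) / N ^ 2)
        ≤ 16 * Real.pi ^ 2 * (4 * ((ℓ + (N + 1)) / (N + 1) ^ 2)) := by gcongr
      _ = _ := by ring

/-! ### Union bound for long walks -/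

lemma exists_form_of_endpoint {n ℓ : ℕ} (hn : 2 ≤ n) (x : Fin ℓ → Fin (n - 1) × ℤˣ) :
    ∃ c : Fin (n - 1) → ℤ, (∀ i, c i ≠ 0) ∧ ∀ y : Fin ℓ → Fin (n - 1) × ℤˣ,
      ¬ HasFullStep n (G (wordEquiv n ℓ x, wordEquiv n ℓ y)) →
        (∃ i, walkForm (Pi.single i 1) x = 0) ∨ walkForm c y = 0 := by
  by_cases h : ∃ i, walkForm (Pi.single i 1) x = 0
  -- When the first walk has a zero coordinate the form is irrelevant; any nonzero coefficients keep
  -- the later bound uniform in x.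
  · exact ⟨fun _ => 1, fun _ => one_ne_zero, fun _ _ => Or.inl h⟩
  · push Not at h
    obtain ⟨c, hc, hfull⟩ := exists_hasFullStep hn (wordEquiv n ℓ x).endpoint fun i hi => by
      have := h ⟨i, by omega⟩
      rwa [← superdiag_endpoint] at this
    refine ⟨c, hc, fun y hy => Or.inr ?_⟩
    by_contra hne
    rw [← sum_superdiag_endpoint] at hne
    exact hy (hfull _ hne)

lemma cosMoment_nonneg (ℓ : ℕ) : 0 ≤ cosMoment ℓ := by
  have hpi := Real.pi_pos
  exact mul_nonneg (by positivity)
    (intervalIntegral.integral_nonneg (by linarith) fun _ _ => by positivity)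

/-- The number of pairs of walks such that the first has a vanishing coordinate or the second
satisfies a linear equation depending on the first. -/
lemma card_zero_or_form_le {N : ℕ} (hN : 0 < N) (ℓ : ℕ) {c : (Fin ℓ → Fin N × ℤˣ) → Fin N → ℤ}
    (hc : ∀ x i, c x i ≠ 0) :
    (Nat.card {q : (Fin ℓ → Fin N × ℤˣ) × (Fin ℓ → Fin N × ℤˣ) //
      (∃ i, walkForm (Pi.single i 1) q.1 = 0) ∨ walkForm (c q.1) q.2 = 0} : ℝ) ≤
      (N * returnProb N ℓ + cosMoment ℓ) * ((2 * N) ^ ℓ) ^ 2 := by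
  rw [card_subtype_eq_sum]
  have hT : ∀ a : ℝ, ∑ _x : Fin ℓ → Fin N × ℤˣ, a = a * (2 * N) ^ ℓ := by
    intro a
    rw [Finset.sum_const, Finset.card_univ, ← Nat.card_eq_fintype_card, card_walk, nsmul_eq_mul,
      mul_comm]
    push_cast
    rfl
  calc _ ≤ ∑ q : (Fin ℓ → Fin N × ℤˣ) × (Fin ℓ → Fin N × ℤˣ),
        (∑ i, (if walkForm (Pi.single i 1) q.1 = 0 then (1 : ℝ) else 0) +
          if walkForm (c q.1) q.2 = 0 then 1 else 0) := by
        refine Finset.sum_le_sum fun q _ => ?_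
        have h1 : ∀ i ∈ (Finset.univ : Finset (Fin N)),
            (0 : ℝ) ≤ if walkForm (Pi.single i 1) q.1 = 0 then (1 : ℝ) else 0 := fun i _ => by
          split_ifs <;> norm_num
        have h2 := Finset.sum_nonneg h1
        split_ifs with h3 h4 h4
        · linarith
        · obtain ⟨i, hi⟩ := h3.resolve_right h4
          have := Finset.single_le_sum h1 (Finset.mem_univ i)
          rw [if_pos hi] at this
          linarith
        · linarith
        · linarith
    _ = (∑ x : Fin ℓ → Fin N × ℤˣ, ∑ i,
          (if walkForm (Pi.single i 1) x = 0 then (1 : ℝ) else 0)) * (2 * N) ^ ℓ +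
        ∑ x, ∑ y, (if walkForm (c x) y = 0 then (1 : ℝ) else 0) := by
        rw [Finset.sum_add_distrib, Fintype.sum_prod_type, Fintype.sum_prod_type, Finset.sum_mul]
        exact congrArg₂ _ (Finset.sum_congr rfl fun x _ =>
          hT (∑ i, if walkForm (Pi.single i 1) x = 0 then 1 else 0)) rfl
    _ ≤ (N * (returnProb N ℓ * (2 * N) ^ ℓ)) * (2 * N) ^ ℓ +
        ∑ _x : Fin ℓ → Fin N × ℤˣ, cosMoment ℓ * (2 * N) ^ ℓ := by
        rw [Finset.sum_comm]
        refine add_le_add (le_of_eq ?_) (Finset.sum_le_sum fun x _ => ?_)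
        · simp_rw [← card_subtype_eq_sum, card_coord_eq_zero hN]
          simp
        · rw [← card_subtype_eq_sum]
          exact card_walkForm_le hN ℓ (hc x)
    _ = _ := by
        rw [hT]
        ring

lemma prob_not_hasFullStep_le {n : ℕ} (hn : 3 ≤ n) (ℓ : ℕ) :
    prob n ℓ (fun H => ¬ HasFullStep n H) ≤
      ((n - 1 : ℕ) : ℝ) * returnProb (n - 1) ℓ + cosMoment ℓ := by
  choose c hc hfull using fun x => exists_form_of_endpoint (ℓ := ℓ) (by omega : 2 ≤ n) x
  have h1 := returnProb_nonneg (by omega : 2 ≤ n - 1) ℓ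
  have h2 := cosMoment_nonneg ℓ
  exact prob_le (by positivity) (fun q hq => hfull q.1 q.2 hq)
    (card_zero_or_form_le (by omega) ℓ hc)

/-! ### The two asymptotic regimes -/

lemma aas_not_hasFullStep {ℓ : ℕ → ℕ}
    (h : (fun n : ℕ => (ℓ n : ℝ)) =o[atTop] (fun n : ℕ => (n : ℝ) ^ 2)) :
    AAS ℓ (fun n H => ¬ HasFullStep n H) := by
  have h1 : Tendsto (fun n : ℕ => (ℓ n : ℝ) / n ^ 2 + (n : ℝ)⁻¹) atTop (𝓝 (0 + 0)) :=
    h.tendsto_div_nhds_zero.add tendsto_inv_atTop_nhds_zero_nat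
  have h2 := h1.const_mul (64 * Real.pi ^ 2)
  rw [add_zero, mul_zero] at h2
  refine aas_of_prob_not_le h2 ?_
  filter_upwards [eventually_ge_atTop 5] with n hn
  have hn' : (n : ℝ) ≠ 0 := by positivity
  simp only [not_not]
  refine (prob_hasFullStep_le hn (ℓ n)).trans (le_of_eq ?_)
  field_simp

lemma aas_hasFullStep {ℓ : ℕ → ℕ}
    (h : (fun n : ℕ => (n : ℝ) ^ 3) =o[atTop] (fun n : ℕ => (ℓ n : ℝ))) :
    AAS ℓ (fun n H => HasFullStep n H) := by
  have hle : ∀ᶠ n in atTop, n ≤ ℓ n := by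
    filter_upwards [h.bound one_pos] with n hn
    rw [one_mul, Real.norm_of_nonneg (by positivity), Real.norm_of_nonneg (by positivity)] at hn
    have h1 : n ^ 3 ≤ ℓ n := by exact_mod_cast hn
    exact (Nat.le_self_pow (by norm_num) n).trans h1
  have hℓ : Tendsto ℓ atTop atTop := tendsto_atTop_mono' _ hle tendsto_id
  have h1 : Tendsto (fun n : ℕ => (2 * Real.pi)⁻¹ * √(Real.pi ^ 3 / 2 * ((n : ℝ) ^ 3 / ℓ n)) +
      cosMoment (ℓ n)) atTop (𝓝 ((2 * Real.pi)⁻¹ * √(Real.pi ^ 3 / 2 * 0) + 0)) :=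
    (((h.tendsto_div_nhds_zero.const_mul _).sqrt).const_mul _).add (tendsto_cosMoment.comp hℓ)
  rw [mul_zero, Real.sqrt_zero, mul_zero, add_zero] at h1
  refine aas_of_prob_not_le h1 ?_
  filter_upwards [hle, eventually_ge_atTop 3] with n hn hn3
  refine (prob_not_hasFullStep_le hn3 (ℓ n)).trans (add_le_add ?_ le_rfl)
  have h2 := returnProb_le (N := n - 1) (ℓ := ℓ n) (by omega) (by omega)
  have h3 : ((n - 1 : ℕ) : ℝ) ≤ n := by exact_mod_cast Nat.sub_le n 1
  have hpi := Real.pi_pos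
  calc ((n - 1 : ℕ) : ℝ) * returnProb (n - 1) (ℓ n)
      ≤ n * ((2 * Real.pi)⁻¹ * √(Real.pi ^ 3 / 2 * (n / ℓ n))) := by
        refine mul_le_mul h3 (h2.trans ?_) (returnProb_nonneg (by omega) _) (by positivity)
        gcongr
    -- Moving the n of the union bound under the root turns n / ℓ into n³ / ℓ, which is where the
    -- threshold n³ arises.
    _ = (2 * Real.pi)⁻¹ * (√((n : ℝ) ^ 2) * √(Real.pi ^ 3 / 2 * (n / ℓ n))) := by
        rw [Real.sqrt_sq (by positivity)]
        ring
    _ = _ := by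
        rw [← Real.sqrt_mul (by positivity)]
        congr 2
        ring

end RandomNilpotent

theorem theorem2 (ℓ : ℕ → ℕ) :
    ((fun n : ℕ => (ℓ n : ℝ)) =o[atTop] (fun n : ℕ => (n : ℝ) ^ 2) →
      RandomNilpotent.AAS ℓ (fun n H => ¬ RandomNilpotent.HasFullStep n H)) ∧
    ((fun n : ℕ => (n : ℝ) ^ 3) =o[atTop] (fun n : ℕ => (ℓ n : ℝ)) →
      RandomNilpotent.AAS ℓ (fun n H => RandomNilpotent.HasFullStep n H)) :=
  ⟨RandomNilpotent.aas_not_hasFullStep, RandomNilpotent.aas_hasFullStep⟩
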